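/- All graphs are finite and simple. For graphs $G_0,G_1$ with disjoint vertex sets of the same size and a bijection $\phi:V(G_0)\to V(G_1)$, let $G_0\oplus_\phi G_1$ be the graph with vertex set $V(G_0)\cup V(G_1)$ and edge set $E(G_0)\cup E(G_1)\cup\{v\phi(v): v\in V(G_0)\}$. Let $G(8,4)$ be the graph with vertices $v_0,\dots,v_7$ in which $v_iv_j$ is an edge if and only if $j-i\equiv \pm1$ or $4\pmod 8$. The restricted hypercube-like graphs are defined recursively (up to isomorphism): the only one of dimension $3$ is $G(8,4)$, and for $m\ge 4$ those of dimension $m$ are the graphs $G_0\oplus_\phi G_1$ with $G_0,G_1$ restricted hypercube-like graphs of dimension $m-1$ and $\phi:V(G_0)\to V(G_1)$ any bijection. A fractional perfect matching of a graph $G$ is a function $f:E(G)\to[0,1]$ such that, for every vertex $v$, the sum of $f(e)$ over all edges $e$ incident to $v$ equals $1$. The fractional strong matching preclusion number $\mathrm{fsmp}(G)$ is the minimum size of a set $F\subseteq V(G)\cup E(G)$ such that $G-F$ has no fractional perfect matching. **Theorem.** For every $m\ge 5$ and every $m$-dimensional restricted hypercube-like graph $G$, one has $\mathrm{fsmp}(G)=m$.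 In particular, for every set $F$ of vertices and/or edges of $G$ with $|F|=m-1$, the graph $G-F$ has a fractional perfect matching. -/

import Mathlib

universe u v

/-- For graphs `G₀`, `G₁` and a bijection `φ` of their vertex sets, the graph `G₀ ⊕_φ G₁` on the
disjoint union of the vertex sets: the edges of `G₀`, the edges of `G₁`, and all edges `v φ(v)`. -/
def bijectiveSum {V₀ : Type u} {V₁ : Type v} (G₀ : SimpleGraph V₀) (G₁ : SimpleGraph V₁)
    (φ : V₀ ≃ V₁) : SimpleGraph (V₀ ⊕ V₁) where
  Adj
    | Sum.inl a, Sum.inl b => G₀.Adj a b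
    | Sum.inr a, Sum.inr b => G₁.Adj a b
    | Sum.inl a, Sum.inr b => φ a = b
    | Sum.inr a, Sum.inl b => φ b = a
  symm := ⟨by
    rintro (a | a) (b | b) h
    · exact SimpleGraph.Adj.symm h
    · exact h
    · exact h
    · exact SimpleGraph.Adj.symm h⟩
  loopless := ⟨by
    rintro (a | a) h
    · exact G₀.loopless.irrefl a h
    · exact G₁.loopless.irrefl a h⟩

/-- The recursive circulant `G(8,4)`: vertices are the integers modulo `8`, and `i`, `j` are
adjacent when they differ by `±1` or by `4`. -/
def recursiveCirculant84 : SimpleGraph (ZMod 8) :=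
  SimpleGraph.circulantGraph {1, 4}

/-- `IsRestrictedHL m G`: the graph `G` is (isomorphic to) an `m`-dimensional restricted
hypercube-like graph. In dimension `3` this is `G(8,4)` only; in dimension `m + 1` these are the
graphs `G₀ ⊕_φ G₁` with `G₀`, `G₁` of dimension `m` and `φ` an arbitrary bijection. There are none
of dimension less than `3`. -/
inductive IsRestrictedHL : ℕ → ∀ {V : Type u}, SimpleGraph V → Prop
  | base {V : Type u} (G : SimpleGraph V) (e : G ≃g recursiveCirculant84) : IsRestrictedHL 3 G
  | step {m : ℕ} {V₀ V₁ V : Type u} (G₀ : SimpleGraph V₀) (G₁ : SimpleGraph V₁)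
      (φ : V₀ ≃ V₁) (G : SimpleGraph V) (e : G ≃g bijectiveSum G₀ G₁ φ)
      (h₀ : IsRestrictedHL m G₀) (h₁ : IsRestrictedHL m G₁) : IsRestrictedHL (m + 1) G

/-- A fractional perfect matching of a finite graph: weights in `[0,1]` on the edges, with sum
exactly `1` over the edges incident to each vertex. Values of `f` off the edge set are
irrelevant. -/
def IsFractionalPerfectMatching {V : Type u} [Finite V] (G : SimpleGraph V)
    (f : Sym2 V → ℝ) : Prop :=
  (∀ e ∈ G.edgeSet, 0 ≤ f e ∧ f e ≤ 1) ∧ ∀ v : V, ∑ᶠ e ∈ G.incidenceSet v, f e = 1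

def HasFractionalPerfectMatching {V : Type u} [Finite V] (G : SimpleGraph V) : Prop :=
  ∃ f : Sym2 V → ℝ, IsFractionalPerfectMatching G f

/-- The graph `G - F`, where `F` consists of the vertices in `S` and the edges in `T`. -/
def deleteFaults {V : Type u} (G : SimpleGraph V) (S : Finset V) (T : Finset (Sym2 V)) :
    SimpleGraph {v : V // v ∉ S} :=
  (G.deleteEdges (T : Set (Sym2 V))).comap Subtype.val

/-- The set `F` consisting of the vertices in `S` and of the edges in `T` is a fractional strong
matching preclusion set of `G`. -/
def IsFSMPSet {V : Type u} [Finite V] (G : SimpleGraph V) (S : Finset V)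
    (T : Finset (Sym2 V)) : Prop :=
  (T : Set (Sym2 V)) ⊆ G.edgeSet ∧ ¬ HasFractionalPerfectMatching (deleteFaults G S T)

/-- The fractional strong matching preclusion number: the minimum size of a fractional strong
matching preclusion set. (The value is `0` if there is no such set.) -/
noncomputable def fsmp {V : Type u} [Finite V] (G : SimpleGraph V) : ℕ :=
  sInf {k : ℕ | ∃ (S : Finset V) (T : Finset (Sym2 V)), IsFSMPSet G S T ∧ S.card + T.card = k}

/-!
A permutation `σ` of the vertices with `v ~ σ v` for all `v` gives a fractional perfect matching:
every vertex `v` puts weight `1/2` on the edge from `v` to `σ v`. Hence it suffices to find such a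
permutation (`Cover`) of `G - F` for every set `F` of at most `m - 1` faults. For the upper bound,
`G` has a vertex of degree at most `m`, and deleting the edges at it leaves an isolated vertex.

The covers are found by induction on the dimension, together with path covers (`PathCover`), in
which a single prescribed pair `b → a` need not be an edge. Let `G = G₀ ⊕_φ G₁`. If the faults in
either half are few enough for that half, the covers of the halves are put together. Otherwise all
faults lie in `G₀`, say. One of them is restored, `G₀` is covered, and the cover is corrected where
it uses the restored fault. If that fault is a vertex `x`, lying on the cover between `p` and `q`,
then `p → x → q` is replaced by a detour from `φ p` to `φ q` through `G₁`, given by a path cover of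
`G₁` (`SplitCoverable.of_vertex`). If it is an edge used in one direction, it is replaced by a detour
in the same way; if it is used in both directions, its ends are matched with their partners in `G₁`
(`SplitCoverable.of_edge`).

This step works from dimension `5` on. The start needs more care, since a four-dimensional graph
minus one vertex and two edges need not have a cover. When these are the faults in `G₀`, the vertex
`x` is the one that is restored; at most one fault lies outside `G₀`, and if it spoils the connection of
one vertex to `G₁`, the edge from that vertex to `x` is declared faulty as well, because three faulty
edges in dimension `4` are harmless (`ToleratesFour.splitCoverable`). The facts in dimension `4`
follow by the same moves from facts about `G(8,4)` (`ToleratesThree`), and these are verified by a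
search through its permutations. That `G(8,4)` is not bipartite is essential here: otherwise there
would be no path cover between two vertices on the same side.
-/

/-! ### Permutations along edges -/

/-- Some permutation of `V` sends every `v` to a point `R`-related to it. -/
def HasPerm {V : Type u} (R : V → V → Prop) : Prop :=
  ∃ σ : Equiv.Perm V, ∀ v, R v (σ v)

/-- A permutation fixing `S` pointwise and moving every other vertex along an edge of `H`:
a cover of `H - S` by disjoint edges and directed cycles. -/
def Cover {V : Type u} (H : SimpleGraph V) (S : Finset V) : Prop :=
  HasPerm fun v w => (v ∈ S → w = v) ∧ (v ∉ S → H.Adj v w)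

/-- A permutation as in `Cover`, except that `b` is sent to `a`, whether or not they are adjacent:
a cover of `H - S` by a directed path from `a` to `b` and disjoint edges and directed cycles.
Only used for `a`, `b` outside `S`; for `a = b` the path is a single vertex. -/
def PathCover {V : Type u} (H : SimpleGraph V) (S : Finset V) (a b : V) : Prop :=
  HasPerm fun v w => (v = b → w = a) ∧ (v ∈ S → w = v) ∧ (v ∉ S → v ≠ b → H.Adj v w)

section Basic

variable {V : Type u} {W : Type v} {H H' : SimpleGraph V} {S : Finset V} {a b : V}

theorem HasPerm.mono {R R' : V → V → Prop} (h : HasPerm R) (hR : ∀ x y, R x y → R' x y) :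
    HasPerm R' :=
  h.imp fun _ hσ v => hR _ _ (hσ v)

theorem HasPerm.transport {R : V → V → Prop} {R' : W → W → Prop} (e : V ≃ W) (h : HasPerm R')
    (hR : ∀ x y, R' (e x) (e y) → R x y) : HasPerm R := by
  obtain ⟨σ, hσ⟩ := h
  refine ⟨(e.trans σ).trans e.symm, fun v => hR _ _ ?_⟩
  simpa using hσ (e v)

theorem Cover.transport {H' : SimpleGraph W} {S' : Finset W} (e : V ≃ W) (h : Cover H' S')
    (hH : ∀ x y, H'.Adj (e x) (e y) → H.Adj x y) (hS : ∀ x, e x ∈ S' ↔ x ∈ S) : Cover H S := by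
  refine HasPerm.transport e h fun x y hxy => ?_
  simp only [hS, EmbeddingLike.apply_eq_iff_eq] at hxy
  exact ⟨hxy.1, fun hx => hH _ _ (hxy.2 hx)⟩

theorem PathCover.transport {H' : SimpleGraph W} {S' : Finset W} (e : V ≃ W)
    (h : PathCover H' S' (e a) (e b))
    (hH : ∀ x y, H'.Adj (e x) (e y) → H.Adj x y) (hS : ∀ x, e x ∈ S' ↔ x ∈ S) :
    PathCover H S a b := by
  refine HasPerm.transport e h fun x y hxy => ?_
  simp only [hS, EmbeddingLike.apply_eq_iff_eq, ne_eq] at hxy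
  exact ⟨hxy.1, hxy.2.1, fun hx hb => hH _ _ (hxy.2.2 hx hb)⟩

/-- Reversing the cycles reverses the path. -/
theorem PathCover.symm (ha : a ∉ S) (h : PathCover H S a b) : PathCover H S b a := by
  obtain ⟨σ, hσ⟩ := h
  have hba : σ b = a := (hσ b).1 rfl
  refine ⟨σ.symm, fun v => ⟨?_, fun hv => ?_, fun hv hva => ?_⟩⟩
  · rintro rfl
    rw [Equiv.symm_apply_eq, hba]
  · rw [Equiv.symm_apply_eq, (hσ v).2.1 hv]
  · have h1 := hσ (σ.symm v)
    rw [Equiv.apply_symm_apply] at h1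
    refine (h1.2.2 (fun hs => hv ?_) fun hb => hva (h1.1 hb)).symm
    rwa [h1.2.1 hs]

/-- Removing a vertex `x` from its cycle leaves a path from its successor to its predecessor. -/
theorem Cover.exists_pathCover_insert [DecidableEq V] {x : V} (h : Cover H S) (hx : x ∉ S) :
    ∃ p q, p ∉ insert x S ∧ q ∉ insert x S ∧ H.Adj p x ∧ H.Adj x q ∧
      PathCover H (insert x S) q p := by
  obtain ⟨σ, hσ⟩ := h
  have hout : ∀ v, σ v ∈ S → v ∈ S := fun v hv => by
    have h1 := (hσ (σ v)).1 hv
    rwa [σ.injective h1] at hv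
  have hxq := (hσ x).2 hx
  obtain ⟨p, hp⟩ := σ.surjective x
  have hpS : p ∉ S := fun hpS => hx (by rw [← hp, (hσ p).1 hpS]; exact hpS)
  have hpx := (hσ p).2 hpS
  rw [hp] at hpx
  refine ⟨p, σ x, ?_, ?_, hpx, hxq, σ.trans (Equiv.swap x (σ x)), fun v => ⟨?_, fun hv => ?_,
    fun hv hvp => ?_⟩⟩
  · simp [hpS, hpx.ne]
  · simp only [Finset.mem_insert, not_or]
    exact ⟨hxq.ne', fun h => hx (hout _ h)⟩
  · rintro rfl
    simp [hp]
  · rcases Finset.mem_insert.1 hv with rfl | hv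
    · simp
    · have h1 := (hσ v).1 hv
      simp only [Equiv.trans_apply, h1]
      refine Equiv.swap_apply_of_ne_of_ne ?_ ?_
      · exact fun h => hx (h ▸ hv)
      · exact fun h => hx (hout _ (h ▸ hv))
  · simp only [Finset.mem_insert, not_or] at hv
    have h1 : σ v ≠ x := fun h => hvp (σ.injective (h.trans hp.symm))
    have h2 : σ v ≠ σ x := fun h => hv.1 (σ.injective h)
    simp only [Equiv.trans_apply, Equiv.swap_apply_of_ne_of_ne h1 h2]
    exact (hσ v).2 hv.2

/-- If the edge `e` becomes unavailable, the cover either does not use it, or traverses it in one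
direction, or in both. -/
theorem Cover.edge_cases [DecidableEq V] {T : Finset (Sym2 V)} {e : Sym2 V} {G : SimpleGraph V}
    (h : Cover (G.deleteEdges (T.erase e : Finset (Sym2 V))) S) :
    Cover (G.deleteEdges T) S ∨
    (∃ p q, p ∉ S ∧ q ∉ S ∧ PathCover (G.deleteEdges T) S q p) ∨
    ∃ p q, p ∉ S ∧ q ∉ S ∧ p ≠ q ∧ Cover (G.deleteEdges T) (insert p (insert q S)) := by
  obtain ⟨σ, hσ⟩ := h
  have hout : ∀ v, v ∉ S → σ v ∉ S := fun v hv' hv => by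
    have h1 := (hσ (σ v)).1 hv
    rw [σ.injective h1] at hv
    exact hv' hv
  have key : ∀ v, v ∉ S → s(v, σ v) ≠ e → (G.deleteEdges T).Adj v (σ v) := fun v hv hne => by
    have h1 := (hσ v).2 hv
    simp only [SimpleGraph.deleteEdges_adj, Finset.coe_erase] at h1 ⊢
    exact ⟨h1.1, fun h => h1.2 ⟨h, hne⟩⟩
  by_cases h0 : ∃ p, p ∉ S ∧ s(p, σ p) = e
  · obtain ⟨p, hpS, rfl⟩ := h0
    have hqS := hout p hpS
    have hpq := ((hσ p).2 hpS).ne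
    by_cases h2 : σ (σ p) = p
    · refine .inr (.inr ⟨p, σ p, hpS, hqS, hpq, (Equiv.swap p (σ p)).trans σ, fun v =>
        ⟨fun hv => ?_, fun hv => ?_⟩⟩)
      · simp only [Finset.mem_insert] at hv
        rcases hv with rfl | rfl | hv
        · simp [h2]
        · simp
        · rw [Equiv.trans_apply, Equiv.swap_apply_of_ne_of_ne]
          · exact (hσ v).1 hv
          · rintro rfl; exact hpS hv
          · rintro rfl; exact hqS hv
      · simp only [Finset.mem_insert, not_or] at hv
        rw [Equiv.trans_apply, Equiv.swap_apply_of_ne_of_ne hv.1 hv.2.1]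
        refine key v hv.2.2 fun h => ?_
        rcases Sym2.eq_iff.1 h with h | h
        · exact hv.1 h.1
        · exact hv.2.1 h.1
    · refine .inr (.inl ⟨p, σ p, hpS, hqS, σ, fun v => ⟨?_, (hσ v).1, fun hv hvp => ?_⟩⟩)
      · rintro rfl; rfl
      · refine key v hv fun h => ?_
        rcases Sym2.eq_iff.1 h with h | h
        · exact hvp h.1
        · rw [h.1] at h; exact h2 h.2
  · push Not at h0
    exact .inl ⟨σ, fun v => ⟨(hσ v).1, fun hv => key v hv (h0 v hv)⟩⟩

/-- Two adjacent uncovered vertices can be matched with each other. -/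
theorem Cover.of_insert_insert [DecidableEq V] {x y : V} (h : Cover H (insert x (insert y S)))
    (hxy : H.Adj x y) (hx : x ∉ S) (hy : y ∉ S) : Cover H S := by
  obtain ⟨σ, hσ⟩ := h
  have hσx : σ x = x := (hσ x).1 (by simp)
  have hσy : σ y = y := (hσ y).1 (by simp)
  refine ⟨(Equiv.swap x y).trans σ, fun v => ?_⟩
  by_cases hvx : v = x
  · subst hvx; simp [hx, hσy, hxy]
  by_cases hvy : v = y
  · subst hvy; simp [hy, hσx, hxy.symm]
  · simpa [Equiv.swap_apply_of_ne_of_ne hvx hvy, hvx, hvy] using hσ v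

end Basic

/-! ### Splicing permutations of the two halves -/

section Splice

variable {V₀ V₁ : Type u} {R₀ : V₀ → V₀ → Prop} {R₁ : V₁ → V₁ → Prop}
  {R : V₀ ⊕ V₁ → V₀ ⊕ V₁ → Prop}

theorem HasPerm.sum (h₀ : HasPerm R₀) (h₁ : HasPerm R₁)
    (hl : ∀ x y, R₀ x y → R (.inl x) (.inl y)) (hr : ∀ x y, R₁ x y → R (.inr x) (.inr y)) :
    HasPerm R := by
  obtain ⟨σ, hσ⟩ := h₀
  obtain ⟨τ, hτ⟩ := h₁
  refine ⟨Equiv.sumCongr σ τ, ?_⟩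
  rintro (x | x)
  · exact hl _ _ (hσ x)
  · exact hr _ _ (hτ x)

/-- The arcs `p → σ p` and `q → τ q` are replaced by `p → τ q` and `q → σ p`. -/
theorem HasPerm.splice (σ : Equiv.Perm V₀) (τ : Equiv.Perm V₁) (p : V₀) (q : V₁)
    (hl : ∀ x, x ≠ p → R (.inl x) (.inl (σ x))) (hr : ∀ y, y ≠ q → R (.inr y) (.inr (τ y)))
    (hp : R (.inl p) (.inr (τ q))) (hq : R (.inr q) (.inl (σ p))) : HasPerm R := by
  classical
  refine ⟨(Equiv.sumCongr σ τ).trans (Equiv.swap (.inl (σ p)) (.inr (τ q))), ?_⟩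
  rintro (x | y)
  · by_cases hx : x = p
    · subst hx; simpa using hp
    · rw [Equiv.trans_apply, Equiv.swap_apply_of_ne_of_ne]
      · exact hl x hx
      · simpa using hx
      · simp
  · by_cases hy : y = q
    · subst hy; simpa using hq
    · rw [Equiv.trans_apply, Equiv.swap_apply_of_ne_of_ne]
      · exact hr y hy
      · simp
      · simpa using hy

end Splice

section FaultySum

variable {V₀ V₁ : Type u}

/-- `K` contains the bijective sum of `H₀` and `H₁` along `φ`, except possibly for the cross edges
at the vertices of `C`. -/
structure FaultySum (H₀ : SimpleGraph V₀) (H₁ : SimpleGraph V₁) (φ : V₀ ≃ V₁) (C : Finset V₀)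
    (K : SimpleGraph (V₀ ⊕ V₁)) : Prop where
  left : ∀ x y, H₀.Adj x y → K.Adj (.inl x) (.inl y)
  right : ∀ x y, H₁.Adj x y → K.Adj (.inr x) (.inr y)
  cross : ∀ x, x ∉ C → K.Adj (.inl x) (.inr (φ x))

namespace FaultySum

variable {H₀ : SimpleGraph V₀} {H₁ : SimpleGraph V₁} {φ : V₀ ≃ V₁} {C : Finset V₀}
  {K : SimpleGraph (V₀ ⊕ V₁)} {S₀ : Finset V₀} {S₁ : Finset V₁}

theorem swap (h : FaultySum H₀ H₁ φ C K) :
    FaultySum H₁ H₀ φ.symm (C.map φ.toEmbedding) (K.comap Sum.swap) where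
  left := h.right
  right := h.left
  cross x hx := by
    have h1 := h.cross (φ.symm x) fun hc =>
      hx (by simpa using Finset.mem_map_of_mem φ.toEmbedding hc)
    simpa using h1.symm

theorem cover (h : FaultySum H₀ H₁ φ C K) (h₀ : Cover H₀ S₀) (h₁ : Cover H₁ S₁) :
    Cover K (S₀.disjSum S₁) := by
  refine HasPerm.sum h₀ h₁ (fun x y hxy => ?_) fun x y hxy => ?_
  · simpa using ⟨hxy.1, fun hx => h.left _ _ (hxy.2 hx)⟩
  · simpa using ⟨hxy.1, fun hx => h.right _ _ (hxy.2 hx)⟩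

theorem pathCover_left (h : FaultySum H₀ H₁ φ C K) {a b : V₀} (h₀ : PathCover H₀ S₀ a b)
    (h₁ : Cover H₁ S₁) : PathCover K (S₀.disjSum S₁) (.inl a) (.inl b) := by
  refine HasPerm.sum h₀ h₁ (fun x y hxy => ?_) fun x y hxy => ?_
  · simpa using ⟨hxy.1, hxy.2.1, fun hx hb => h.left _ _ (hxy.2.2 hx hb)⟩
  · simpa using ⟨hxy.1, fun hx => h.right _ _ (hxy.2 hx)⟩

/-- A path in one half is closed up to a cycle through the other half. -/
theorem cover_of_pathCover (h : FaultySum H₀ H₁ φ C K) {p q : V₀} (hp : p ∉ S₀)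
    (hpC : p ∉ C) (hqC : q ∉ C) (hq₁ : φ q ∉ S₁) (h₀ : PathCover H₀ S₀ q p)
    (h₁ : PathCover H₁ S₁ (φ p) (φ q)) : Cover K (S₀.disjSum S₁) := by
  obtain ⟨σ, hσ⟩ := h₀
  obtain ⟨τ, hτ⟩ := h₁
  refine HasPerm.splice σ τ p (φ q) (fun x hx => ?_) (fun y hy => ?_) ?_ ?_
  · simpa using ⟨(hσ x).2.1, fun hxS => h.left _ _ ((hσ x).2.2 hxS hx)⟩
  · simpa using ⟨(hτ y).2.1, fun hyS => h.right _ _ ((hτ y).2.2 hyS hy)⟩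
  · rw [(hτ _).1 rfl]
    simpa [hp] using h.cross p hpC
  · rw [(hσ _).1 rfl]
    simpa [hq₁] using (h.cross q hqC).symm

/-- Two vertices uncovered in the first half are matched to their partners in the second. -/
theorem cover_of_insert [DecidableEq V₀] [DecidableEq V₁] (h : FaultySum H₀ H₁ φ C K) {p q : V₀}
    (hp : p ∉ S₀) (hq : q ∉ S₀) (hpq : p ≠ q)
    (hpC : p ∉ C) (hqC : q ∉ C) (hp₁ : φ p ∉ S₁) (hq₁ : φ q ∉ S₁)
    (h₀ : Cover H₀ (insert p (insert q S₀)))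
    (h₁ : Cover H₁ (insert (φ p) (insert (φ q) S₁))) : Cover K (S₀.disjSum S₁) := by
  have h2 := h.cover h₀ h₁
  have hS : (insert p (insert q S₀)).disjSum (insert (φ p) (insert (φ q) S₁)) =
      insert (.inl p) (insert (.inr (φ p)) (insert (.inl q) (insert (.inr (φ q))
        (S₀.disjSum S₁)))) := by
    ext (x | x) <;> simp
  rw [hS] at h2
  have h3 := h2.of_insert_insert (h.cross p hpC) (by simp [hp, hpq]) (by simp [hp₁, hpq])
  exact h3.of_insert_insert (h.cross q hqC) (by simp [hq]) (by simp [hq₁])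

/-- A path with one end in each half is glued along a cross edge. -/
theorem pathCover_cross (h : FaultySum H₀ H₁ φ C K) {a z : V₀} {b : V₁} (hz : z ∉ S₀)
    (hb : b ∉ S₁) (hzC : z ∉ C) (h₀ : PathCover H₀ S₀ a z) (h₁ : PathCover H₁ S₁ (φ z) b) :
    PathCover K (S₀.disjSum S₁) (.inl a) (.inr b) := by
  obtain ⟨σ, hσ⟩ := h₀
  obtain ⟨τ, hτ⟩ := h₁
  refine HasPerm.splice σ τ z b (fun x hx => ?_) (fun y hy => ?_) ?_ ?_
  · simpa using ⟨(hσ x).2.1, fun hxS => h.left _ _ ((hσ x).2.2 hxS hx)⟩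
  · simpa [hy] using ⟨(hτ y).2.1, fun hyS => h.right _ _ ((hτ y).2.2 hyS hy)⟩
  · rw [(hτ _).1 rfl]
    simpa [hz] using h.cross z hzC
  · rw [(hσ _).1 rfl]
    simpa using hb

/-- With `x → a` and `b → y` in a cover of the first half, these arcs are replaced by `b → a` and
a detour from `x` to `y` through the second half. -/
theorem pathCover_left_of_cover (h : FaultySum H₀ H₁ φ ∅ K) {a b : V₀} (ha : a ∉ S₀) (hb : b ∉ S₀)
    (h₀ : Cover H₀ S₀) (h₁ : Cover H₁ ∅) (h₁' : ∀ x y, PathCover H₁ ∅ x y) :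
    PathCover K (S₀.disjSum ∅) (.inl a) (.inl b) := by
  classical
  obtain ⟨σ, hσ⟩ := h₀
  by_cases hba : σ b = a
  · refine h.pathCover_left ⟨σ, fun v => ⟨?_, (hσ v).1, fun hv _ => (hσ v).2 hv⟩⟩ h₁
    rintro rfl; exact hba
  obtain ⟨x, hx⟩ := σ.surjective a
  have hxS : x ∉ S₀ := fun hxS => ha (by rw [← hx, (hσ x).1 hxS]; exact hxS)
  have hxb : x ≠ b := by rintro rfl; exact hba hx
  obtain ⟨τ, hτ⟩ := h₁' (φ x) (φ (σ b))
  have hbb : (σ.trans (Equiv.swap a (σ b))) b = a := by simp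
  have hxx : (σ.trans (Equiv.swap a (σ b))) x = σ b := by simp [hx]
  refine HasPerm.splice (σ.trans (Equiv.swap a (σ b))) τ x (φ (σ b)) (fun v hv => ?_)
    (fun y hy => ?_) ?_ ?_
  · by_cases hvb : v = b
    · subst hvb
      rw [hbb]
      simp [hb]
    · rw [Equiv.trans_apply, Equiv.swap_apply_of_ne_of_ne]
      · simpa [hvb] using ⟨(hσ v).1, fun hv => h.left _ _ ((hσ v).2 hv)⟩
      · exact fun h => hv (σ.injective (h.trans hx.symm))
      · exact fun h => hvb (σ.injective h)
  · simpa using h.right _ _ ((hτ y).2.2 (by simp) hy)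
  · rw [(hτ _).1 rfl]
    simpa [hxS, hxb] using h.cross x (by simp)
  · rw [hxx]
    simpa using (h.cross (σ b) (by simp)).symm

end FaultySum

end FaultySum

/-! ### Fault tolerance of a bijective sum -/

/-- After the deletion of any `s` vertices and at most `t` edges there is a cover. -/
def FaultCoverable {V : Type u} (G : SimpleGraph V) (s t : ℕ) : Prop :=
  ∀ (S : Finset V) (T : Finset (Sym2 V)), S.card = s → T.card ≤ t → Cover (G.deleteEdges T) S

/-- After the deletion of any `s` vertices and at most `t` edges there is a path cover between any
two remaining vertices, equal ones included. -/
def FaultPathCoverable {V : Type u} (G : SimpleGraph V) (s t : ℕ) : Prop :=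
  ∀ (S : Finset V) (T : Finset (Sym2 V)) (a b : V), S.card = s → T.card ≤ t → a ∉ S → b ∉ S →
    PathCover (G.deleteEdges T) S a b

/-- In every bijective sum of `G₀` and `G₁`, after the deletion of any `sᵢ` vertices and at most `tᵢ`
edges of `Gᵢ` for `i = 0, 1`, and of at most `c` cross edges, there is a cover. -/
def SplitCoverable {V₀ V₁ : Type u} (G₀ : SimpleGraph V₀) (G₁ : SimpleGraph V₁)
    (s₀ t₀ s₁ t₁ c : ℕ) : Prop :=
  ∀ (φ : V₀ ≃ V₁) (K : SimpleGraph (V₀ ⊕ V₁)) (S₀ : Finset V₀) (S₁ : Finset V₁)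
    (T₀ : Finset (Sym2 V₀)) (T₁ : Finset (Sym2 V₁)) (C : Finset V₀),
    FaultySum (G₀.deleteEdges T₀) (G₁.deleteEdges T₁) φ C K →
    S₀.card = s₀ → T₀.card ≤ t₀ → S₁.card = s₁ → T₁.card ≤ t₁ → C.card ≤ c →
    Cover K (S₀.disjSum S₁)

section

variable {V : Type u} {W : Type v} {G : SimpleGraph V} {G' : SimpleGraph W} {s t t' : ℕ}

theorem FaultCoverable.mono (h : FaultCoverable G s t) (ht : t' ≤ t) : FaultCoverable G s t' :=
  fun S T hS hT => h S T hS (hT.trans ht)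

theorem deleteEdges_adj_of_map (e : G ≃g G') (T : Finset (Sym2 V)) (x y : V)
    (h : (G'.deleteEdges (T.map e.toEquiv.toEmbedding.sym2Map : Finset (Sym2 W))).Adj (e x) (e y)) :
    (G.deleteEdges T).Adj x y := by
  simp only [SimpleGraph.deleteEdges_adj] at h ⊢
  refine ⟨e.map_adj_iff.1 h.1, fun hT => h.2 ?_⟩
  have := Finset.mem_map_of_mem e.toEquiv.toEmbedding.sym2Map (Finset.mem_coe.1 hT)
  simpa using this

theorem apply_mem_map_toEmbedding (e : G ≃g G') (S : Finset V) (x : V) :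
    e x ∈ S.map e.toEquiv.toEmbedding ↔ x ∈ S :=
  Finset.mem_map' e.toEquiv.toEmbedding

theorem FaultCoverable.of_iso (e : G ≃g G') (h : FaultCoverable G' s t) : FaultCoverable G s t :=
  fun S T hS hT => (h (S.map e.toEquiv.toEmbedding) (T.map e.toEquiv.toEmbedding.sym2Map)
    (by simpa using hS) (by simpa using hT)).transport e.toEquiv
      (deleteEdges_adj_of_map e T) (apply_mem_map_toEmbedding e S)

theorem FaultPathCoverable.of_iso (e : G ≃g G') (h : FaultPathCoverable G' s t) :
    FaultPathCoverable G s t :=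
  fun S T a b hS hT ha hb => (h (S.map e.toEquiv.toEmbedding)
    (T.map e.toEquiv.toEmbedding.sym2Map) (e a) (e b) (by simpa using hS) (by simpa using hT)
    (by rwa [apply_mem_map_toEmbedding]) (by rwa [apply_mem_map_toEmbedding])).transport e.toEquiv
      (deleteEdges_adj_of_map e T) (apply_mem_map_toEmbedding e S)

/-- A path cover with equal ends is a cover with one more vertex deleted. -/
theorem FaultPathCoverable.faultCoverable (h : FaultPathCoverable G s t) :
    FaultCoverable G (s + 1) t := by
  classical
  intro S T hS hT
  obtain ⟨x, hx⟩ : S.Nonempty := Finset.card_pos.1 (by omega)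
  have h1 := h (S.erase x) T x x (by rw [Finset.card_erase_of_mem hx]; omega) hT (by simp)
    (by simp)
  refine h1.mono fun v w hvw => ⟨fun hv => ?_, fun hv => ?_⟩
  · by_cases hvx : v = x
    · rw [hvx]; exact hvw.1 hvx
    · exact hvw.2.1 (by simp [hvx, hv])
  · have hvx : v ≠ x := by rintro rfl; exact hv hx
    exact hvw.2.2 (by simp [hv]) hvx

end

section

variable {V₀ V₁ : Type u} {G₀ : SimpleGraph V₀} {G₁ : SimpleGraph V₁} {s₀ t₀ s₁ t₁ c s t : ℕ}

/-- The faulty edges of a bijective sum are distributed over the two halves and the cross edges. -/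
theorem exists_faultySum (φ : V₀ ≃ V₁) (T : Finset (Sym2 (V₀ ⊕ V₁))) :
    ∃ (T₀ : Finset (Sym2 V₀)) (T₁ : Finset (Sym2 V₁)) (C : Finset V₀),
      T₀.card + T₁.card + C.card ≤ T.card ∧
      FaultySum (G₀.deleteEdges T₀) (G₁.deleteEdges T₁) φ C
        ((bijectiveSum G₀ G₁ φ).deleteEdges T) := by
  classical
  have i₀ : Function.Injective (Sym2.map (Sum.inl : V₀ → V₀ ⊕ V₁)) :=
    Sym2.map.injective Sum.inl_injective
  have i₁ : Function.Injective (Sym2.map (Sum.inr : V₁ → V₀ ⊕ V₁)) :=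
    Sym2.map.injective Sum.inr_injective
  have i₂ : Function.Injective fun x : V₀ => s((Sum.inl x : V₀ ⊕ V₁), Sum.inr (φ x)) := by
    intro x y h
    simpa using h
  refine ⟨T.preimage _ i₀.injOn, T.preimage _ i₁.injOn, T.preimage _ i₂.injOn, ?_, ?_, ?_, ?_⟩
  · rw [← Finset.card_image_of_injective (T.preimage _ i₀.injOn) i₀,
      ← Finset.card_image_of_injective (T.preimage _ i₁.injOn) i₁,
      ← Finset.card_image_of_injective (T.preimage _ i₂.injOn) i₂,
      ← Finset.card_union_of_disjoint, ← Finset.card_union_of_disjoint]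
    · refine Finset.card_le_card fun e he => ?_
      simp only [Finset.mem_union, Finset.mem_image, Finset.mem_preimage] at he
      rcases he with (⟨x, hx, rfl⟩ | ⟨x, hx, rfl⟩) | ⟨x, hx, rfl⟩ <;> exact hx
    · rw [Finset.disjoint_left]
      rintro e he he'
      simp only [Finset.mem_union, Finset.mem_image] at he he'
      obtain ⟨z, -, rfl⟩ := he'
      rcases he with ⟨x, -, hx⟩ | ⟨x, -, hx⟩ <;> induction x with | _ x y => simp at hx
    · rw [Finset.disjoint_left]
      rintro e he he'
      simp only [Finset.mem_image] at he he'
      obtain ⟨z, -, rfl⟩ := he'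
      obtain ⟨x, -, hx⟩ := he
      induction x with | _ x y => induction z with | _ z w => simp at hx
  · intro x y h
    simpa [bijectiveSum] using h
  · intro x y h
    simpa [bijectiveSum] using h
  · intro x hx
    simpa [bijectiveSum] using hx

theorem SplitCoverable.swap (h : SplitCoverable G₁ G₀ s₁ t₁ s₀ t₀ c) :
    SplitCoverable G₀ G₁ s₀ t₀ s₁ t₁ c := by
  intro φ K S₀ S₁ T₀ T₁ C hK hS₀ hT₀ hS₁ hT₁ hC
  refine (h _ _ S₁ S₀ T₁ T₀ _ hK.swap hS₁ hT₁ hS₀ hT₀ (by simpa using hC)).transport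
    (Equiv.sumComm V₀ V₁) ?_ ?_
  · simp
  · rintro (x | x) <;> simp

/-- It suffices to treat the distributions of the faults in which the first half has at least as
many as the second. -/
theorem faultCoverable_bijectiveSum (φ : V₀ ≃ V₁)
    (h : ∀ s₀ t₀ s₁ t₁ c, s₀ + s₁ = s → t₀ + t₁ + c ≤ t → s₁ + t₁ ≤ s₀ + t₀ →
      SplitCoverable G₀ G₁ s₀ t₀ s₁ t₁ c ∧ SplitCoverable G₁ G₀ s₀ t₀ s₁ t₁ c) :
    FaultCoverable (bijectiveSum G₀ G₁ φ) s t := by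
  intro S T hS hT
  obtain ⟨T₀, T₁, C, hcard, hK⟩ := exists_faultySum (G₀ := G₀) (G₁ := G₁) φ T
  have hS' := Finset.card_toLeft_add_card_toRight (u := S)
  have key : SplitCoverable G₀ G₁ S.toLeft.card T₀.card S.toRight.card T₁.card C.card := by
    rcases le_total (S.toRight.card + T₁.card) (S.toLeft.card + T₀.card) with hle | hle
    · exact (h _ _ _ _ _ (by omega) (by omega) hle).1
    · exact (h _ _ _ _ _ (by omega) (by omega) hle).2.swap
  have := key φ _ S.toLeft S.toRight T₀ T₁ C hK rfl le_rfl rfl le_rfl le_rfl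
  rwa [Finset.toLeft_disjSum_toRight] at this

theorem FaultCoverable.splitCoverable (h₀ : FaultCoverable G₀ s₀ t₀)
    (h₁ : FaultCoverable G₁ s₁ t₁) : SplitCoverable G₀ G₁ s₀ t₀ s₁ t₁ c :=
  fun _ _ _ _ _ _ _ hK hS₀ hT₀ hS₁ hT₁ _ => hK.cover (h₀ _ _ hS₀ hT₀) (h₁ _ _ hS₁ hT₁)

/-- A faulty vertex `x` is restored, and the resulting cover of the first half is rerouted around
`x` through the second half. The edges at `x` from vertices whose partner or cross edge is faulty
count as faulty, so that the neighbours of `x` on its cycle have an intact connection to the second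
half. -/
theorem SplitCoverable.of_vertex (h₀ : FaultCoverable G₀ s₀ (t₀ + s₁ + c))
    (h₁ : FaultPathCoverable G₁ s₁ t₁) : SplitCoverable G₀ G₁ (s₀ + 1) t₀ s₁ t₁ c := by
  classical
  intro φ K S₀ S₁ T₀ T₁ C hK hS₀ hT₀ hS₁ hT₁ hC
  obtain ⟨x, hx⟩ : S₀.Nonempty := Finset.card_pos.1 (by omega)
  let B : Finset V₀ := S₁.map φ.symm.toEmbedding ∪ C
  let T : Finset (Sym2 V₀) := T₀ ∪ B.image fun z => s(z, x)
  have hT : T.card ≤ t₀ + s₁ + c := by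
    refine (Finset.card_union_le _ _).trans ?_
    have h1 : (B.image fun z => s(z, x)).card ≤ B.card := Finset.card_image_le
    have h2 : B.card ≤ (S₁.map φ.symm.toEmbedding).card + C.card := Finset.card_union_le _ _
    rw [Finset.card_map] at h2
    omega
  have hcov := h₀ (S₀.erase x) T (by rw [Finset.card_erase_of_mem hx]; omega) hT
  obtain ⟨p, q, hp, hq, hpx, hxq, hpath⟩ := hcov.exists_pathCover_insert (x := x) (by simp)
  rw [Finset.insert_erase hx] at hp hq hpath
  have hB : ∀ z, (G₀.deleteEdges (T : Set (Sym2 V₀))).Adj z x → φ z ∉ S₁ ∧ z ∉ C := by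
    intro z hz
    have hzB : z ∉ B := fun hzB => (SimpleGraph.deleteEdges_adj.1 hz).2 (by
      simp only [T, Finset.coe_union, Set.mem_union, Finset.mem_coe, Finset.mem_image]
      exact .inr ⟨z, hzB, rfl⟩)
    simpa [B, Equiv.symm_apply_eq] using hzB
  refine hK.cover_of_pathCover hp (hB p hpx).2 (hB q hxq.symm).2 (hB q hxq.symm).1 ?_
    (h₁ _ _ _ _ hS₁ hT₁ (hB p hpx).1 (hB q hxq.symm).1)
  refine hpath.mono fun v w hvw => ⟨hvw.1, hvw.2.1, fun hv hvp => ?_⟩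
  have := hvw.2.2 hv hvp
  simp only [SimpleGraph.deleteEdges_adj, T, Finset.coe_union, Set.mem_union, not_or] at this ⊢
  exact ⟨this.1, this.2.1⟩

/-- A faulty edge is restored, and the resulting cover of the first half is rerouted around it
through the second half. -/
theorem SplitCoverable.of_edge (h₀ : FaultCoverable G₀ s₀ t₀)
    (h₁ : FaultPathCoverable G₁ 0 t₁) (h₁' : FaultCoverable G₁ 2 t₁)
    (h₁'' : FaultCoverable G₁ 0 t₁) :
    SplitCoverable G₀ G₁ s₀ (t₀ + 1) 0 t₁ 0 := by
  classical
  intro φ K S₀ S₁ T₀ T₁ C hK hS₀ hT₀ hS₁ hT₁ hC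
  obtain rfl : S₁ = ∅ := Finset.card_eq_zero.1 hS₁
  obtain rfl : C = ∅ := Finset.card_eq_zero.1 (by omega)
  rcases T₀.eq_empty_or_nonempty with rfl | ⟨e, he⟩
  · exact hK.cover (h₀ _ _ hS₀ (by simp)) (h₁'' _ _ rfl hT₁)
  rcases (h₀ S₀ (T₀.erase e) hS₀ (by rw [Finset.card_erase_of_mem he]; omega)).edge_cases with
    h | ⟨p, q, hp, hq, h⟩ | ⟨p, q, hp, hq, hpq, h⟩
  · exact hK.cover h (h₁'' _ _ rfl hT₁)
  · exact hK.cover_of_pathCover hp (by simp) (by simp) (by simp) h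
      (h₁ _ _ _ _ rfl hT₁ (by simp) (by simp))
  · refine hK.cover_of_insert hp hq hpq (by simp) (by simp) (by simp) (by simp) h
      (h₁' _ _ ?_ hT₁)
    rw [Finset.card_insert_of_notMem (by simpa using hpq)]
    simp

end

/-! ### Path covers of a bijective sum -/

/-- The analogue of `SplitCoverable` for path covers. -/
def SplitPathCoverable {V₀ V₁ : Type u} (G₀ : SimpleGraph V₀) (G₁ : SimpleGraph V₁)
    (s₀ t₀ s₁ t₁ c : ℕ) : Prop :=
  ∀ (φ : V₀ ≃ V₁) (K : SimpleGraph (V₀ ⊕ V₁)) (S₀ : Finset V₀) (S₁ : Finset V₁)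
    (T₀ : Finset (Sym2 V₀)) (T₁ : Finset (Sym2 V₁)) (C : Finset V₀) (a b : V₀ ⊕ V₁),
    FaultySum (G₀.deleteEdges T₀) (G₁.deleteEdges T₁) φ C K →
    S₀.card = s₀ → T₀.card ≤ t₀ → S₁.card = s₁ → T₁.card ≤ t₁ → C.card ≤ c →
    a ∉ S₀.disjSum S₁ → b ∉ S₀.disjSum S₁ → PathCover K (S₀.disjSum S₁) a b

section

variable {V₀ V₁ : Type u} {G₀ : SimpleGraph V₀} {G₁ : SimpleGraph V₁} {s₀ t₀ s₁ t₁ c s t : ℕ}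

theorem FaultySum.pathCover_right {H₀ : SimpleGraph V₀} {H₁ : SimpleGraph V₁} {φ : V₀ ≃ V₁}
    {C : Finset V₀} {K : SimpleGraph (V₀ ⊕ V₁)} {S₀ : Finset V₀} {S₁ : Finset V₁}
    (h : FaultySum H₀ H₁ φ C K) {a b : V₁} (h₀ : Cover H₀ S₀)
    (h₁ : PathCover H₁ S₁ a b) : PathCover K (S₀.disjSum S₁) (.inr a) (.inr b) := by
  refine (h.swap.pathCover_left h₁ h₀).transport (Equiv.sumComm V₀ V₁) ?_ ?_
  · simp
  · rintro (x | x) <;> simp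

theorem SplitPathCoverable.swap (h : SplitPathCoverable G₁ G₀ s₁ t₁ s₀ t₀ c) :
    SplitPathCoverable G₀ G₁ s₀ t₀ s₁ t₁ c := by
  intro φ K S₀ S₁ T₀ T₁ C a b hK hS₀ hT₀ hS₁ hT₁ hC ha hb
  refine PathCover.transport (Equiv.sumComm V₀ V₁) (h _ _ S₁ S₀ T₁ T₀ _ a.swap b.swap hK.swap hS₁
    hT₁ hS₀ hT₀ (by simpa using hC) ?_ ?_) ?_ ?_
  · cases a <;> simpa using ha
  · cases b <;> simpa using hb
  · simp
  · rintro (x | x) <;> simp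

/-- It suffices to treat the distributions of the faults in which the first half has at least as
many as the second. -/
theorem faultPathCoverable_bijectiveSum (φ : V₀ ≃ V₁)
    (h : ∀ s₀ t₀ s₁ t₁ c, s₀ + s₁ = s → t₀ + t₁ + c ≤ t → s₁ + t₁ ≤ s₀ + t₀ →
      SplitPathCoverable G₀ G₁ s₀ t₀ s₁ t₁ c ∧ SplitPathCoverable G₁ G₀ s₀ t₀ s₁ t₁ c) :
    FaultPathCoverable (bijectiveSum G₀ G₁ φ) s t := by
  intro S T a b hS hT ha hb
  obtain ⟨T₀, T₁, C, hcard, hK⟩ := exists_faultySum (G₀ := G₀) (G₁ := G₁) φ T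
  have hS' := Finset.card_toLeft_add_card_toRight (u := S)
  have key : SplitPathCoverable G₀ G₁ S.toLeft.card T₀.card S.toRight.card T₁.card C.card := by
    rcases le_total (S.toRight.card + T₁.card) (S.toLeft.card + T₀.card) with hle | hle
    · exact (h _ _ _ _ _ (by omega) (by omega) hle).1
    · exact (h _ _ _ _ _ (by omega) (by omega) hle).2.swap
  have := key φ _ S.toLeft S.toRight T₀ T₁ C a b hK rfl le_rfl rfl le_rfl le_rfl
  rw [Finset.toLeft_disjSum_toRight] at this
  exact this ha hb

/-- By reversal, of the two positions of a pair of ends in different halves only one has to be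
treated. -/
theorem SplitPathCoverable.of_cases
    (h : ∀ (φ : V₀ ≃ V₁) (K : SimpleGraph (V₀ ⊕ V₁)) (S₀ : Finset V₀) (S₁ : Finset V₁)
      (T₀ : Finset (Sym2 V₀)) (T₁ : Finset (Sym2 V₁)) (C : Finset V₀),
      FaultySum (G₀.deleteEdges T₀) (G₁.deleteEdges T₁) φ C K →
      S₀.card = s₀ → T₀.card ≤ t₀ → S₁.card = s₁ → T₁.card ≤ t₁ → C.card ≤ c →
      (∀ a b, a ∉ S₀ → b ∉ S₀ → PathCover K (S₀.disjSum S₁) (.inl a) (.inl b)) ∧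
      (∀ a b, a ∉ S₁ → b ∉ S₁ → PathCover K (S₀.disjSum S₁) (.inr a) (.inr b)) ∧
      (∀ a b, a ∉ S₀ → b ∉ S₁ → PathCover K (S₀.disjSum S₁) (.inl a) (.inr b))) :
    SplitPathCoverable G₀ G₁ s₀ t₀ s₁ t₁ c := by
  intro φ K S₀ S₁ T₀ T₁ C a b hK hS₀ hT₀ hS₁ hT₁ hC ha hb
  obtain ⟨hll, hrr, hlr⟩ := h φ K S₀ S₁ T₀ T₁ C hK hS₀ hT₀ hS₁ hT₁ hC
  rcases a with a | a <;> rcases b with b | b <;>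
    simp only [Finset.inl_mem_disjSum, Finset.inr_mem_disjSum] at ha hb
  · exact hll a b ha hb
  · exact hlr a b ha hb
  · exact (hlr b a hb ha).symm (by simpa using hb)
  · exact hrr a b ha hb

/-- With path covers in both halves, ends in different halves are joined along a cross edge that is
intact; `hcard` provides one. -/
theorem FaultPathCoverable.splitPathCoverable (h₀ : FaultPathCoverable G₀ s₀ t₀)
    (h₁ : FaultPathCoverable G₁ s₁ t₁) (h₀' : FaultCoverable G₀ s₀ t₀)
    (h₁' : FaultCoverable G₁ s₁ t₁) (hcard : ∀ B : Finset V₀, B.card ≤ s₀ + s₁ + c → ∃ z, z ∉ B) :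
    SplitPathCoverable G₀ G₁ s₀ t₀ s₁ t₁ c := by
  classical
  refine .of_cases fun φ K S₀ S₁ T₀ T₁ C hK hS₀ hT₀ hS₁ hT₁ hC => ⟨fun a b ha hb => ?_,
    fun a b ha hb => ?_, fun a b ha hb => ?_⟩
  · exact hK.pathCover_left (h₀ _ _ _ _ hS₀ hT₀ ha hb) (h₁' _ _ hS₁ hT₁)
  · exact hK.pathCover_right (h₀' _ _ hS₀ hT₀) (h₁ _ _ _ _ hS₁ hT₁ ha hb)
  · obtain ⟨z, hz⟩ := hcard (S₀ ∪ S₁.map φ.symm.toEmbedding ∪ C) (by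
      refine (Finset.card_union_le _ _).trans (add_le_add ((Finset.card_union_le _ _).trans ?_) hC)
      rw [Finset.card_map, hS₀, hS₁])
    simp only [Finset.mem_union, not_or, Finset.mem_map_equiv, Equiv.symm_symm] at hz
    exact hK.pathCover_cross hz.1.1 hb hz.2 (h₀ _ _ _ _ hS₀ hT₀ ha hz.1.1)
      (h₁ _ _ _ _ hS₁ hT₁ hz.1.2 hb)

/-- The first half may have `t` faulty edges as long as it has a path cover from any given vertex
to at least one other. -/
theorem SplitPathCoverable.of_exists_end (h₀ : FaultCoverable G₀ 0 t)
    (h₀' : ∀ T : Finset (Sym2 V₀), T.card ≤ t → ∀ a, ∃ z, PathCover (G₀.deleteEdges T) ∅ a z)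
    (h₁ : FaultPathCoverable G₁ 0 0) (h₁' : FaultCoverable G₁ 0 0) :
    SplitPathCoverable G₀ G₁ 0 t 0 0 0 := by
  refine .of_cases fun φ K S₀ S₁ T₀ T₁ C hK hS₀ hT₀ hS₁ hT₁ hC => ?_
  obtain rfl : S₁ = ∅ := Finset.card_eq_zero.1 hS₁
  obtain rfl : S₀ = ∅ := Finset.card_eq_zero.1 hS₀
  obtain rfl : C = ∅ := Finset.card_eq_zero.1 (by omega)
  refine ⟨fun a b ha hb => ?_, fun a b ha hb => ?_, fun a b ha hb => ?_⟩
  · exact hK.pathCover_left_of_cover ha hb (h₀ _ _ rfl hT₀) (h₁' _ _ rfl hT₁)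
      fun x y => h₁ _ _ _ _ rfl hT₁ (by simp) (by simp)
  · exact hK.pathCover_right (h₀ _ _ rfl hT₀) (h₁ _ _ _ _ rfl hT₁ ha hb)
  · obtain ⟨z, hz⟩ := h₀' T₀ hT₀ a
    exact hK.pathCover_cross (by simp) hb (by simp) hz (h₁ _ _ _ _ rfl hT₁ (by simp) hb)

end

/-! ### The recursive circulant `G(8,4)` -/

/-- Backtracking search for an injective choice, for each element of a list of sources, of an
`R`-related element of a list of targets. -/
def searchInj {α : Type*} [DecidableEq α] (R : α → α → Bool) : List α → List α → Bool
  | [], _ => true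
  | v :: vs, ws => ws.any fun w => R v w && searchInj R vs (ws.erase w)

theorem exists_of_searchInj {α : Type*} [DecidableEq α] {R : α → α → Bool} :
    ∀ {vs ws : List α}, vs.Nodup → ws.Nodup → searchInj R vs ws = true →
      ∃ f : α → α, (∀ v ∈ vs, R v (f v) = true ∧ f v ∈ ws) ∧ Set.InjOn f {v | v ∈ vs}
  | [], _, _, _, _ => ⟨id, by simp, by simp⟩
  | v :: vs, ws, hv, hw, h => by
    simp only [searchInj, List.any_eq_true, Bool.and_eq_true] at h
    obtain ⟨w, hws, hR, h⟩ := h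
    rw [List.nodup_cons] at hv
    obtain ⟨f, hf, hinj⟩ := exists_of_searchInj hv.2 (hw.erase w) h
    have hne : ∀ x ∈ vs, x ≠ v := fun x hx hxv => hv.1 (hxv ▸ hx)
    refine ⟨Function.update f v w, fun x hx => ?_, ?_⟩
    · rcases List.mem_cons.1 hx with rfl | hx
      · simpa using ⟨hR, hws⟩
      · rw [Function.update_of_ne (hne x hx)]
        exact ⟨(hf x hx).1, List.mem_of_mem_erase (hf x hx).2⟩
    · have hfw : ∀ x ∈ vs, f x ≠ w := fun x hx hxw => by
        have := (hf x hx).2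
        rw [hxw, hw.mem_erase_iff] at this
        exact this.1 rfl
      intro x hx y hy hxy
      rcases List.mem_cons.1 hx with hxv | hx <;> rcases List.mem_cons.1 hy with hyv | hy
      · rw [hxv, hyv]
      · rw [hxv, Function.update_self, Function.update_of_ne (hne y hy)] at hxy
        exact absurd hxy.symm (hfw y hy)
      · rw [hyv, Function.update_self, Function.update_of_ne (hne x hx)] at hxy
        exact absurd hxy (hfw x hx)
      · rw [Function.update_of_ne (hne x hx), Function.update_of_ne (hne y hy)] at hxy
        exact hinj hx hy hxy

theorem hasPerm_of_searchInj {α : Type*} [DecidableEq α] [Finite α] {R : α → α → Bool}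
    {l : List α} (hl : l.Nodup) (hmem : ∀ x, x ∈ l) (h : searchInj R l l = true) :
    HasPerm fun v w => R v w = true := by
  obtain ⟨f, hf, hinj⟩ := exists_of_searchInj hl hl h
  have hf' : Function.Injective f := fun x y => hinj (hmem x) (hmem y)
  exact ⟨Equiv.ofBijective f (Finite.injective_iff_bijective.1 hf'), fun v => (hf v (hmem v)).1⟩

/-- Search for a permutation of the vertices of `G(8,4)` along `R`. -/
def circSearch (R : ZMod 8 → ZMod 8 → Bool) : Bool :=
  searchInj R [0, 1, 2, 3, 4, 5, 6, 7] [0, 1, 2, 3, 4, 5, 6, 7]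

/-- Adjacency in `G(8,4)`. -/
def circAdj (x y : ZMod 8) : Bool := y - x == 1 || y - x == 4 || y - x == 7

/-- The pair `x y` is not the pair `a b`, in either order. -/
def avoids (a b x y : ZMod 8) : Bool := !((x == a && y == b) || (x == b && y == a))

theorem hasPerm_of_circSearch {R : ZMod 8 → ZMod 8 → Bool} (h : circSearch R = true) :
    HasPerm fun v w => R v w = true :=
  hasPerm_of_searchInj (by decide) (by decide) h

theorem circSearch_edges : ∀ a b c d : ZMod 8,
    circSearch (fun x y => circAdj x y && avoids a b x y && avoids c d x y) = true := by
  decide +kernel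

theorem circSearch_ends : ∀ a b : ZMod 8,
    circSearch (fun x y => if x = b then y = a else circAdj x y) = true := by
  decide +kernel

theorem circSearch_vertex_ends : ∀ v a b : ZMod 8, a ≠ v → b ≠ v →
    circSearch (fun x y => if x = b then y = a else if x = v then y = x else circAdj x y) =
      true := by
  decide +kernel

theorem circSearch_exists_end : ∀ c d a : ZMod 8, ∃ z,
    circSearch (fun x y => if x = z then y = a else circAdj x y && avoids c d x y) = true := by
  decide +kernel

theorem recursiveCirculant84_adj_of_circAdj {x y : ZMod 8} (h : circAdj x y = true) :
    recursiveCirculant84.Adj x y := by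
  have key : ∀ x y : ZMod 8, circAdj x y = true →
      ¬x = y ∧ ((x - y = 1 ∨ x - y = 4) ∨ (y - x = 1 ∨ y - x = 4)) := by decide
  exact (SimpleGraph.circulantGraph_adj _ _ _).mpr (key x y h)

theorem ne_of_avoids {a b x y : ZMod 8} (h : avoids a b x y = true) : s(x, y) ≠ s(a, b) := by
  simpa [avoids, or_iff_not_imp_left] using h

theorem Finset.exists_forall_eq_or_eq_of_card_le_two {α : Type*} [Nonempty α] {T : Finset α}
    (hT : T.card ≤ 2) : ∃ e f, ∀ x ∈ T, x = e ∨ x = f := by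
  classical
  rcases T.eq_empty_or_nonempty with rfl | ⟨e, he⟩
  · simp
  obtain ⟨f, hf⟩ := Finset.card_le_one_iff_subset_singleton.1
    (show (T.erase e).card ≤ 1 by rw [Finset.card_erase_of_mem he]; omega)
  refine ⟨e, f, fun x hx => or_iff_not_imp_left.2 fun hxe => ?_⟩
  simpa using hf (Finset.mem_erase.2 ⟨hxe, hx⟩)

theorem faultCoverable_recursiveCirculant84 : FaultCoverable recursiveCirculant84 0 2 := by
  intro S T hS hT
  obtain rfl : S = ∅ := Finset.card_eq_zero.1 hS
  obtain ⟨e, f, hef⟩ := Finset.exists_forall_eq_or_eq_of_card_le_two hT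
  induction e with | _ a b
  induction f with | _ c d
  refine (hasPerm_of_circSearch (circSearch_edges a b c d)).mono fun x y h => ⟨by simp, fun _ => ?_⟩
  simp only [Bool.and_eq_true] at h
  refine SimpleGraph.deleteEdges_adj.2 ⟨recursiveCirculant84_adj_of_circAdj h.1.1, fun hT => ?_⟩
  rcases hef _ hT with h' | h'
  · exact ne_of_avoids h.1.2 h'
  · exact ne_of_avoids h.2 h'

theorem faultPathCoverable_recursiveCirculant84 :
    FaultPathCoverable recursiveCirculant84 0 0 := by
  intro S T a b hS hT _ _
  obtain rfl : S = ∅ := Finset.card_eq_zero.1 hS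
  obtain rfl : T = ∅ := Finset.card_eq_zero.1 (by omega)
  refine (hasPerm_of_circSearch (circSearch_ends a b)).mono fun x y h => ⟨?_, by simp, ?_⟩
  · rintro rfl
    simpa using h
  · intro _ hxb
    rw [if_neg hxb] at h
    simpa using recursiveCirculant84_adj_of_circAdj h

theorem faultPathCoverable_recursiveCirculant84_vertex :
    FaultPathCoverable recursiveCirculant84 1 0 := by
  intro S T a b hS hT ha hb
  obtain ⟨v, rfl⟩ := Finset.card_eq_one.1 hS
  obtain rfl : T = ∅ := Finset.card_eq_zero.1 (by omega)
  rw [Finset.mem_singleton] at ha hb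
  refine (hasPerm_of_circSearch (circSearch_vertex_ends v a b ha hb)).mono fun x y h =>
    ⟨?_, fun hx => ?_, fun hx hxb => ?_⟩
  · rintro rfl
    simpa using h
  · rw [Finset.mem_singleton] at hx
    subst hx
    rw [if_neg (Ne.symm hb), if_pos rfl] at h
    simpa using h
  · rw [Finset.mem_singleton] at hx
    rw [if_neg hxb, if_neg hx] at h
    simpa using recursiveCirculant84_adj_of_circAdj h

theorem exists_pathCover_recursiveCirculant84 (T : Finset (Sym2 (ZMod 8))) (hT : T.card ≤ 1)
    (a : ZMod 8) : ∃ z, PathCover (recursiveCirculant84.deleteEdges T) ∅ a z := by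
  obtain ⟨e, he⟩ : ∃ e, ∀ x ∈ T, x = e := by
    obtain ⟨e, he⟩ := Finset.card_le_one_iff_subset_singleton.1 hT
    exact ⟨e, fun x hx => by simpa using he hx⟩
  induction e with | _ c d
  obtain ⟨z, hz⟩ := circSearch_exists_end c d a
  refine ⟨z, (hasPerm_of_circSearch hz).mono fun x y h => ⟨?_, by simp, fun _ hxz => ?_⟩⟩
  · rintro rfl
    simpa using h
  · rw [if_neg hxz, Bool.and_eq_true] at h
    exact SimpleGraph.deleteEdges_adj.2 ⟨recursiveCirculant84_adj_of_circAdj h.1,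
      fun hT => ne_of_avoids h.2 (he _ hT)⟩

/-! ### Fault tolerance of restricted hypercube-like graphs -/

/-- The properties of `G(8,4)` from which the bounds in dimension `4` are derived. -/
structure ToleratesThree {V : Type u} (G : SimpleGraph V) : Prop where
  cover : FaultCoverable G 0 2
  path : FaultPathCoverable G 0 0
  path_vertex : FaultPathCoverable G 1 0
  exists_end : ∀ T : Finset (Sym2 V), T.card ≤ 1 → ∀ a, ∃ z, PathCover (G.deleteEdges T) ∅ a z

/-- The fault tolerance in dimension `4`: at most three faults, except for one vertex together with
two edges (for which a cover may fail to exist), or one fault in the case of path covers. -/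
structure ToleratesFour {V : Type u} (G : SimpleGraph V) : Prop where
  cover : ∀ s t, s + t ≤ 3 → (s = 1 → t ≤ 1) → FaultCoverable G s t
  path : ∀ s t, s + t ≤ 1 → FaultPathCoverable G s t

section

variable {V : Type u} {W : Type v} {G : SimpleGraph V} {G' : SimpleGraph W}

theorem toleratesThree_recursiveCirculant84 : ToleratesThree recursiveCirculant84 :=
  ⟨faultCoverable_recursiveCirculant84, faultPathCoverable_recursiveCirculant84,
    faultPathCoverable_recursiveCirculant84_vertex, exists_pathCover_recursiveCirculant84⟩

theorem ToleratesThree.of_iso (e : G ≃g G') (h : ToleratesThree G') : ToleratesThree G where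
  cover := h.cover.of_iso e
  path := h.path.of_iso e
  path_vertex := h.path_vertex.of_iso e
  exists_end T hT a := by
    obtain ⟨z, hz⟩ := h.exists_end (T.map e.toEquiv.toEmbedding.sym2Map) (by simpa using hT) (e a)
    refine ⟨e.symm z, PathCover.transport (S' := ∅) e.toEquiv ?_ (deleteEdges_adj_of_map e T)
      (by simp)⟩
    simpa using hz

theorem ToleratesFour.of_iso (e : G ≃g G') (h : ToleratesFour G') : ToleratesFour G :=
  ⟨fun s t hst hs => (h.cover s t hst hs).of_iso e, fun s t hst => (h.path s t hst).of_iso e⟩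

end

section

variable {V₀ V₁ : Type u} {G₀ : SimpleGraph V₀} {G₁ : SimpleGraph V₁} {s t : ℕ}

theorem ToleratesThree.faultCoverable {V : Type u} {G : SimpleGraph V} (h : ToleratesThree G)
    {s t : ℕ} (hst : s + t ≤ 2) (h11 : s = 1 → t = 0) : FaultCoverable G s t := by
  obtain rfl | rfl | rfl : s = 0 ∨ s = 1 ∨ s = 2 := by omega
  · exact h.cover.mono (by omega)
  · exact h.path.faultCoverable.mono (by omega)
  · exact h.path_vertex.faultCoverable.mono (by omega)

theorem ToleratesThree.splitCoverable (h₀ : ToleratesThree G₀) (h₁ : ToleratesThree G₁)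
    {s₀ t₀ s₁ t₁ c : ℕ} (hst : s₀ + t₀ + s₁ + t₁ + c ≤ 3)
    (hne : s₀ + s₁ = 1 → t₀ + t₁ + c ≤ 1) (hle : s₁ + t₁ ≤ s₀ + t₀) :
    SplitCoverable G₀ G₁ s₀ t₀ s₁ t₁ c := by
  by_cases h3 : s₀ + t₀ = 3
  · obtain ⟨rfl, rfl, rfl⟩ : s₁ = 0 ∧ t₁ = 0 ∧ c = 0 := by omega
    by_cases ht : t₀ = 0
    · obtain ⟨rfl, rfl⟩ : s₀ = 2 + 1 ∧ t₀ = 0 := by omega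
      exact .of_vertex (h₀.faultCoverable (by omega) (by omega)) h₁.path
    · obtain ⟨t, rfl⟩ := Nat.exists_eq_succ_of_ne_zero ht
      exact .of_edge (h₀.faultCoverable (by omega) (by omega)) h₁.path
        (h₁.faultCoverable (by omega) (by omega)) (h₁.faultCoverable (by omega) (by omega))
  by_cases h11 : s₀ = 1 ∧ t₀ = 1
  · obtain ⟨rfl, rfl⟩ := h11
    obtain rfl : t₁ = 0 := by omega
    refine .of_vertex (s₀ := 0) (h₀.faultCoverable (by omega) (by omega)) ?_
    obtain rfl | rfl : s₁ = 0 ∨ s₁ = 1 := by omega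
    · exact h₁.path
    · exact h₁.path_vertex
  · exact (h₀.faultCoverable (by omega) (by omega)).splitCoverable
      (h₁.faultCoverable (by omega) (by omega))

theorem ToleratesThree.splitPathCoverable [Nontrivial V₀] (h₀ : ToleratesThree G₀)
    (h₁ : ToleratesThree G₁) {s₀ t₀ s₁ t₁ c : ℕ} (hst : s₀ + t₀ + s₁ + t₁ + c ≤ 1)
    (hle : s₁ + t₁ ≤ s₀ + t₀) : SplitPathCoverable G₀ G₁ s₀ t₀ s₁ t₁ c := by
  obtain ⟨rfl, rfl⟩ : s₁ = 0 ∧ t₁ = 0 := by omega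
  by_cases ht : t₀ = 1
  · obtain ⟨rfl, rfl, rfl⟩ : s₀ = 0 ∧ t₀ = 1 ∧ c = 0 := by omega
    exact .of_exists_end (h₀.faultCoverable (by omega) (by omega)) h₀.exists_end h₁.path
      (h₁.faultCoverable (by omega) (by omega))
  obtain rfl : t₀ = 0 := by omega
  have hpath : FaultPathCoverable G₀ s₀ 0 := by
    obtain rfl | rfl : s₀ = 0 ∨ s₀ = 1 := by omega
    · exact h₀.path
    · exact h₀.path_vertex
  refine hpath.splitPathCoverable h₁.path (h₀.faultCoverable (by omega) (by omega))
    (h₁.faultCoverable (by omega) (by omega)) fun B hB => ?_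
  obtain ⟨x, y, hxy⟩ := exists_pair_ne V₀
  obtain ⟨z, hz⟩ := Finset.card_le_one_iff_subset_singleton.1 (show B.card ≤ 1 by omega)
  by_cases hx : x = z
  · exact ⟨y, fun hy => hxy (hx.trans (Finset.mem_singleton.1 (hz hy)).symm)⟩
  · exact ⟨x, fun hx' => hx (Finset.mem_singleton.1 (hz hx'))⟩

theorem ToleratesThree.toleratesFour [Nontrivial V₀] [Nontrivial V₁] (h₀ : ToleratesThree G₀)
    (h₁ : ToleratesThree G₁) (φ : V₀ ≃ V₁) : ToleratesFour (bijectiveSum G₀ G₁ φ) where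
  cover s t hst hs := faultCoverable_bijectiveSum φ fun s₀ t₀ s₁ t₁ c hs' ht' hle =>
    ⟨h₀.splitCoverable h₁ (by omega) (by omega) hle,
      h₁.splitCoverable h₀ (by omega) (by omega) hle⟩
  path s t hst := faultPathCoverable_bijectiveSum φ fun s₀ t₀ s₁ t₁ c hs' ht' hle =>
    ⟨h₀.splitPathCoverable h₁ (by omega) hle, h₁.splitPathCoverable h₀ (by omega) hle⟩

/-- The one kind of three faults that dimension `4` does not tolerate, a vertex and two edges, is
handled by restoring the vertex, which leaves room for one more faulty edge. -/
theorem ToleratesFour.splitCoverable (h₀ : ToleratesFour G₀) (h₁ : ToleratesFour G₁)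
    {s₀ t₀ s₁ t₁ c : ℕ} (hst : s₀ + t₀ + s₁ + t₁ + c ≤ 4) (hle : s₁ + t₁ ≤ s₀ + t₀) :
    SplitCoverable G₀ G₁ s₀ t₀ s₁ t₁ c := by
  by_cases hv : s₀ ≠ 0 ∧ (s₀ + t₀ = 4 ∧ s₀ ≠ 2 ∨ s₀ = 1 ∧ t₀ = 2)
  · obtain ⟨s, rfl⟩ : ∃ s, s₀ = s + 1 := Nat.exists_eq_succ_of_ne_zero (by omega)
    exact .of_vertex (h₀.cover _ _ (by omega) (by omega)) (h₁.path _ _ (by omega))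
  -- Of two faulty vertices and two faulty edges, an edge is restored: restoring a vertex would leave
  -- one vertex and two edges.
  by_cases h4 : s₀ + t₀ = 4
  · obtain ⟨rfl, rfl, rfl⟩ : s₁ = 0 ∧ t₁ = 0 ∧ c = 0 := by omega
    obtain ⟨t, rfl⟩ : ∃ t, t₀ = t + 1 := Nat.exists_eq_succ_of_ne_zero (by omega)
    exact .of_edge (h₀.cover _ _ (by omega) (by omega)) (h₁.path _ _ (by omega))
      (h₁.cover _ _ (by omega) (by omega)) (h₁.cover _ _ (by omega) (by omega))
  · exact (h₀.cover _ _ (by omega) (by omega)).splitCoverable (h₁.cover _ _ (by omega) (by omega))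

/-- The general step: either both halves tolerate their own faults, or all `k + 1` faults lie in the
first half. -/
theorem splitCoverable_succ {k : ℕ} (hk : 2 ≤ k)
    (h₀ : ∀ s t, s + t ≤ k → FaultCoverable G₀ s t)
    (h₁ : ∀ s t, s + t ≤ k → FaultCoverable G₁ s t) (hp₁ : FaultPathCoverable G₁ 0 0)
    {s₀ t₀ s₁ t₁ c : ℕ} (hst : s₀ + t₀ + s₁ + t₁ + c ≤ k + 1) (hle : s₁ + t₁ ≤ s₀ + t₀) :
    SplitCoverable G₀ G₁ s₀ t₀ s₁ t₁ c := by
  by_cases hall : s₀ + t₀ ≤ k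
  · exact (h₀ _ _ hall).splitCoverable (h₁ _ _ (by omega))
  obtain ⟨rfl, rfl, rfl⟩ : s₁ = 0 ∧ t₁ = 0 ∧ c = 0 := by omega
  rcases s₀ with _ | s
  · obtain ⟨t, rfl⟩ : ∃ t, t₀ = t + 1 := Nat.exists_eq_succ_of_ne_zero (by omega)
    exact .of_edge (h₀ _ _ (by omega)) hp₁ (h₁ _ _ (by omega)) (h₁ _ _ (by omega))
  · exact .of_vertex (h₀ _ _ (by omega)) hp₁

theorem faultPathCoverable_zero_bijectiveSum [Nonempty V₀] [Nonempty V₁]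
    (h₀ : FaultPathCoverable G₀ 0 0) (h₁ : FaultPathCoverable G₁ 0 0)
    (h₀' : FaultCoverable G₀ 0 0) (h₁' : FaultCoverable G₁ 0 0) (φ : V₀ ≃ V₁) :
    FaultPathCoverable (bijectiveSum G₀ G₁ φ) 0 0 := by
  refine faultPathCoverable_bijectiveSum φ fun s₀ t₀ s₁ t₁ c hs' ht' hle => ?_
  obtain ⟨rfl, rfl, rfl, rfl, rfl⟩ : s₀ = 0 ∧ t₀ = 0 ∧ s₁ = 0 ∧ t₁ = 0 ∧ c = 0 := by omega
  refine ⟨h₀.splitPathCoverable h₁ h₀' h₁' fun B hB => ?_,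
    h₁.splitPathCoverable h₀ h₁' h₀' fun B hB => ?_⟩ <;>
  · obtain rfl : B = ∅ := Finset.card_eq_zero.1 (by omega)
    simp

end

namespace IsRestrictedHL

variable {V : Type u} {G : SimpleGraph V} {m : ℕ}

theorem three_le (h : IsRestrictedHL m G) : 3 ≤ m := by
  induction h with
  | base => exact le_rfl
  | step _ _ _ _ _ _ _ ih => omega

theorem nontrivial (h : IsRestrictedHL m G) : Nontrivial V := by
  induction h with
  | base G e =>
    have : Nontrivial (ZMod 8) := inferInstanceAs (Nontrivial (Fin 8))
    exact e.toEquiv.nontrivial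
  | @step _ V₀ V₁ _ _ _ _ _ e _ _ ih =>
    have : Nontrivial (V₀ ⊕ V₁) := (Sum.inl_injective (β := V₁)).nontrivial
    exact e.toEquiv.nontrivial

theorem toleratesThree (h : IsRestrictedHL m G) (hm : m = 3) : ToleratesThree G := by
  cases h with
  | base _ e => exact toleratesThree_recursiveCirculant84.of_iso e
  | step _ _ _ _ _ h₀ => have := h₀.three_le; omega

theorem toleratesFour (h : IsRestrictedHL m G) (hm : m = 4) : ToleratesFour G := by
  cases h with
  | base => omega
  | step G₀ G₁ φ _ e h₀ h₁ =>
    have := h₀.nontrivial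
    have := h₁.nontrivial
    exact ((h₀.toleratesThree (by omega)).toleratesFour (h₁.toleratesThree (by omega)) φ).of_iso e

/-- The existence of path covers without faults, in all dimensions, is what the induction needs in
order to reroute covers through the other half. -/
theorem fault_tolerance (h : IsRestrictedHL m G) : FaultPathCoverable G 0 0 ∧
    FaultCoverable G 0 0 ∧ (5 ≤ m → ∀ s t, s + t ≤ m - 1 → FaultCoverable G s t) := by
  induction h with
  | base G e =>
    have h3 := toleratesThree_recursiveCirculant84.of_iso e
    exact ⟨h3.path, h3.cover.mono (by omega), fun h => by omega⟩
  | @step m V₀ V₁ V G₀ G₁ φ G e h₀ h₁ ih₀ ih₁ =>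
    have := h₀.nontrivial
    have := h₁.nontrivial
    refine ⟨(faultPathCoverable_zero_bijectiveSum ih₀.1 ih₁.1 ih₀.2.1 ih₁.2.1 φ).of_iso e,
      ?_, fun hm s t hst => ?_⟩
    · refine (faultCoverable_bijectiveSum φ fun s₀ t₀ s₁ t₁ c hs' ht' hle => ?_).of_iso e
      obtain ⟨rfl, rfl, rfl, rfl, rfl⟩ : s₀ = 0 ∧ t₀ = 0 ∧ s₁ = 0 ∧ t₁ = 0 ∧ c = 0 := by omega
      exact ⟨ih₀.2.1.splitCoverable ih₁.2.1, ih₁.2.1.splitCoverable ih₀.2.1⟩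
    · refine (faultCoverable_bijectiveSum φ fun s₀ t₀ s₁ t₁ c hs' ht' hle => ?_).of_iso e
      by_cases hm4 : m = 4
      · have hG₀ := h₀.toleratesFour hm4
        have hG₁ := h₁.toleratesFour hm4
        exact ⟨hG₀.splitCoverable hG₁ (by omega) hle, hG₁.splitCoverable hG₀ (by omega) hle⟩
      · have hm5 : 5 ≤ m := by omega
        exact ⟨splitCoverable_succ (k := m - 1) (by omega) (ih₀.2.2 hm5) (ih₁.2.2 hm5) ih₁.1
            (by omega) hle,
          splitCoverable_succ (k := m - 1) (by omega) (ih₁.2.2 hm5) (ih₀.2.2 hm5) ih₀.1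
            (by omega) hle⟩

theorem exists_encard_neighborSet_le (h : IsRestrictedHL m G) :
    ∃ v, (G.neighborSet v).encard ≤ m := by
  induction h with
  | base G e =>
    refine ⟨e.symm 0, ?_⟩
    have h1 : G.neighborSet (e.symm 0) ⊆ e.symm '' {1, 4, 7} := by
      intro w hw
      have h2 : recursiveCirculant84.Adj 0 (e w) := by
        simpa using e.map_adj_iff.2 hw
      refine ⟨e w, ?_, by simp⟩
      have key : ∀ x : ZMod 8, (0 - x = 1 ∨ 0 - x = 4) ∨ (x - 0 = 1 ∨ x - 0 = 4) →
          x = 1 ∨ x = 4 ∨ x = 7 := by decide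
      exact key _ ((SimpleGraph.circulantGraph_adj _ _ _).mp h2).2
    refine (Set.encard_le_encard h1).trans ((Set.encard_image_le _ _).trans ?_)
    refine (Set.encard_insert_le _ _).trans ?_
    have := Set.encard_insert_le ({7} : Set (ZMod 8)) 4
    rw [Set.encard_singleton] at this
    calc _ ≤ (1 + 1 + 1 : ℕ∞) := by gcongr
      _ = _ := by norm_num
  | @step m V₀ V₁ V G₀ G₁ φ G e h₀ h₁ ih₀ ih₁ =>
    obtain ⟨v, hv⟩ := ih₀
    refine ⟨e.symm (.inl v), ?_⟩
    have h1 : G.neighborSet (e.symm (.inl v)) ⊆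
        e.symm '' insert (.inr (φ v)) (Sum.inl '' G₀.neighborSet v) := by
      intro w hw
      have h2 : (bijectiveSum G₀ G₁ φ).Adj (.inl v) (e w) := by
        simpa using e.map_adj_iff.2 hw
      refine ⟨e w, ?_, by simp⟩
      revert h2
      rcases e w with x | x <;> intro h2
      · exact .inr ⟨x, h2, rfl⟩
      · exact .inl (congrArg Sum.inr (show φ v = x from h2).symm)
    refine (Set.encard_le_encard h1).trans ((Set.encard_image_le _ _).trans ?_)
    refine (Set.encard_insert_le _ _).trans ?_
    push_cast
    gcongr
    exact (Set.encard_image_le _ _).trans hv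

end IsRestrictedHL

/-! ### Fractional perfect matchings -/

/-- Every vertex `u` contributes weight `1/2` to the edge from `u` to its image. -/
theorem Cover.hasFractionalPerfectMatching {V : Type u} [Finite V] {G : SimpleGraph V}
    {S : Finset V} {T : Finset (Sym2 V)} (h : Cover (G.deleteEdges T) S) :
    HasFractionalPerfectMatching (deleteFaults G S T) := by
  classical
  have := Fintype.ofFinite V
  obtain ⟨σ, hσ⟩ := h
  have hS : ∀ v, v ∉ S ↔ σ v ∉ S := fun v => by
    refine not_congr ⟨fun hv => by rwa [(hσ v).1 hv], fun hv => ?_⟩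
    have h1 := (hσ (σ v)).1 hv
    rwa [σ.injective h1] at hv
  let τ : Equiv.Perm {v : V // v ∉ S} := σ.subtypePerm fun v => (hS v).symm
  have hτ : ∀ v, (deleteFaults G S T).Adj v (τ v) := fun v => (hσ v).2 v.2
  let f : Sym2 {v : V // v ∉ S} → ℝ := fun e => ∑ u, if s(u, τ u) = e then 1 / 2 else 0
  have hf : ∀ e, 0 ≤ f e := fun e => Finset.sum_nonneg fun u _ => by positivity
  have hsum : ∀ v, ∑ᶠ e ∈ (deleteFaults G S T).incidenceSet v, f e = 1 := by
    intro v
    have hmem : ∀ u, s(u, τ u) ∈ (deleteFaults G S T).incidenceSet v ↔ u = v ∨ u = τ.symm v := by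
      intro u
      rw [SimpleGraph.mk'_mem_incidenceSet_iff]
      simp only [hτ u, true_and]
      rw [Equiv.eq_symm_apply, eq_comm, @eq_comm _ v]
    have hne : v ≠ τ.symm v := fun hv => (hτ v).ne ((Equiv.eq_symm_apply _).1 hv).symm
    rw [finsum_mem_eq_finite_toFinset_sum _ (Set.toFinite _), Finset.sum_comm]
    simp only [Finset.sum_ite_eq, Set.Finite.mem_toFinset, hmem]
    rw [← Finset.sum_filter, Finset.filter_or, Finset.filter_eq', Finset.filter_eq']
    simp only [Finset.mem_univ, if_true]
    rw [Finset.sum_union (by simpa using hne)]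
    norm_num
  refine ⟨f, fun e he => ⟨hf e, ?_⟩, hsum⟩
  induction e with | _ x y
  rw [← hsum x, finsum_mem_eq_finite_toFinset_sum _ (Set.toFinite _)]
  refine Finset.single_le_sum (f := f) (fun e _ => hf e) ?_
  rw [Set.Finite.mem_toFinset, SimpleGraph.mk'_mem_incidenceSet_iff]
  exact ⟨he, .inl rfl⟩

/-- Deleting all edges at a vertex destroys all fractional perfect matchings. -/
theorem isFSMPSet_incidence {V : Type u} [Finite V] (G : SimpleGraph V) (v : V)
    (T : Finset (Sym2 V)) (hT : (T : Set (Sym2 V)) = G.incidenceSet v) : IsFSMPSet G ∅ T := by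
  refine ⟨hT ▸ G.incidenceSet_subset v, ?_⟩
  rintro ⟨f, -, hf⟩
  have h1 := hf ⟨v, by simp⟩
  have h2 : (deleteFaults G ∅ T).incidenceSet ⟨v, by simp⟩ = ∅ := by
    rw [Set.eq_empty_iff_forall_notMem]
    intro e he
    obtain ⟨w, rfl⟩ := Sym2.mem_iff_exists.1 he.2
    have h3 : (G.deleteEdges (T : Set (Sym2 V))).Adj v w := he.1
    rw [SimpleGraph.deleteEdges_adj, hT] at h3
    exact h3.2 ((SimpleGraph.mem_incidenceSet G v _).2 h3.1)
  rw [h2, finsum_mem_empty] at h1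
  exact zero_ne_one h1

theorem mainTheorem1 (m : ℕ) (hm : 5 ≤ m) {V : Type u} [Finite V] (G : SimpleGraph V)
    (hG : IsRestrictedHL m G) :
    fsmp G = m ∧
      ∀ (S : Finset V) (T : Finset (Sym2 V)), (T : Set (Sym2 V)) ⊆ G.edgeSet →
        S.card + T.card = m - 1 → HasFractionalPerfectMatching (deleteFaults G S T) := by
  classical
  have hcov : ∀ (S : Finset V) (T : Finset (Sym2 V)), S.card + T.card ≤ m - 1 →
      HasFractionalPerfectMatching (deleteFaults G S T) := fun S T hST =>
    (hG.fault_tolerance.2.2 hm _ _ hST S T rfl le_rfl).hasFractionalPerfectMatching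
  have hlower : ∀ (S : Finset V) (T : Finset (Sym2 V)), IsFSMPSet G S T →
      m ≤ S.card + T.card := fun S T h => by
    by_contra hlt
    exact h.2 (hcov S T (by omega))
  refine ⟨le_antisymm ?_ ?_, fun S T _ hST => hcov S T hST.le⟩
  · obtain ⟨v, hv⟩ := hG.exists_encard_neighborSet_le
    let T : Finset (Sym2 V) := (Set.toFinite (G.incidenceSet v)).toFinset
    have hT : (T : Set (Sym2 V)) = G.incidenceSet v := by simp [T]
    have hcard : T.card ≤ m := by
      have h1 : (T : Set (Sym2 V)).encard = (G.neighborSet v).encard := by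
        rw [hT]
        exact Set.encard_congr (G.incidenceSetEquivNeighborSet v)
      rw [Set.encard_coe_eq_coe_finsetCard] at h1
      exact_mod_cast h1.trans_le hv
    have hle : fsmp G ≤ (∅ : Finset V).card + T.card :=
      Nat.sInf_le ⟨∅, T, isFSMPSet_incidence G v T hT, rfl⟩
    exact hle.trans (by simpa using hcard)
  · obtain ⟨v, -⟩ := hG.exists_encard_neighborSet_le
    have hT := isFSMPSet_incidence G v (Set.toFinite (G.incidenceSet v)).toFinset (by simp)
    refine le_csInf ⟨_, ∅, _, hT, rfl⟩ ?_
    rintro k ⟨S, T, h, rfl⟩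
    exact hlower S T h
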